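/- Let $k\ge 2$ be an integer and let $a=(a(n))_{n\ge 0}$ be a sequence generated by a finite deterministic automaton with output that reads the base-$k$ expansion of $n$, starting with the most significant digit (each state has exactly one outgoing edge for each of the digits $0,1,\dots,k-1$, and $a(n)$ is the output attached to the state reached from the initial state). Suppose that $a$ is synchronizing, that is, the automaton can be chosen so that there are a word $w\in\{0,1,\dots,k-1\}^*$ and a state $s$ such that reading $w$ leads to $s$ from every state. Then for every real number $c>1$ that is not an integer and every letter $\alpha$, the limits $$\lim_{N\to\infty}\frac1N\,\#\{0\le n<N : a(n)=\alpha\}\qquad\text{and}\qquad \lim_{N\to\infty}\frac1N\,\#\{0\le n<N : a(\lfloor n^c\rfloor)=\alpha\}$$ both exist and are equal. -/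

import Mathlib

/-- A deterministic automaton with output: state set `σ`, input alphabet `{0, …, k - 1}`,
exactly one outgoing edge per state and digit, an initial state, and an output letter in `A`
attached to every state. -/
structure DFAO (k : ℕ) (σ : Type*) (A : Type*) where
  step : σ → Fin k → σ
  start : σ
  output : σ → A

namespace DFAO

variable {k : ℕ} {σ A : Type*}

/-- The state reached from `q` after reading the word `w` from left to right. -/
def run (M : DFAO k σ A) (q : σ) (w : List (Fin k)) : σ :=
  w.foldl M.step q

/-- `w` is a synchronizing (reset) word: after reading `w` the automaton is in one specific
state `s`, no matter in which state it was started. -/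
def IsSynchronizingWord (M : DFAO k σ A) (w : List (Fin k)) : Prop :=
  ∃ s : σ, ∀ q : σ, M.run q w = s

end DFAO

/-- The base-`k` digital expansion of `n`, most significant digit first and without leading
zeros (the expansion of `0` is the empty word). -/
def digitExpansion (k : ℕ) (hk : 1 < k) (n : ℕ) : List (Fin k) :=
  ((Nat.digits k n).pmap (fun d hd => (⟨d, hd⟩ : Fin k))
    (fun _ hd => Nat.digits_lt_base hk hd)).reverse

/-- `M` generates the sequence `a`: on input the base-`k` expansion of `n`, most significant
digit first, `M` stops in a state with output `a n`. -/
def DFAO.Generates {k : ℕ} {σ A : Type*} (M : DFAO k σ A) (hk : 1 < k) (a : ℕ → A) : Prop :=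
  ∀ n : ℕ, M.output (M.run M.start (digitExpansion k hk n)) = a n

/-- `a` is a synchronizing `k`-automatic sequence: it is generated by a finite automaton that has
a synchronizing word. A reset word of one generating automaton also resets the minimal
automaton, which is a quotient of the reachable part. -/
def IsSynchronizingAutomaticBase {A : Type*} (k : ℕ) (hk : 1 < k) (a : ℕ → A) : Prop :=
  ∃ (σ : Type) (_ : Finite σ) (M : DFAO k σ A),
    M.Generates hk a ∧ ∃ w : List (Fin k), M.IsSynchronizingWord w

/-- `a` is a synchronizing automatic sequence (with respect to some base `k ≥ 2`). -/
def IsSynchronizingAutomatic {A : Type*} (a : ℕ → A) : Prop :=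
  ∃ (k : ℕ) (hk : 1 < k), IsSynchronizingAutomaticBase k hk a

/-- The letter `α` has asymptotic frequency `θ` in the sequence `b`:
`#{n < N : b n = α} / N → θ` as `N → ∞`. -/
def HasFrequency {A : Type*} (b : ℕ → A) (α : A) (θ : ℝ) : Prop :=
  Filter.Tendsto (fun N : ℕ => (Set.ncard {n : ℕ | n < N ∧ b n = α} : ℝ) / (N : ℝ))
    Filter.atTop (nhds θ)

/-! A reset word erases all earlier history. Cut the last `j * |w|` digits into `j` blocks: a
residue that fails to reset avoids `w` in every block, so the proportion of such residues is at most
`(1 - k ^ (-|w|)) ^ j`, which tends to 0. Hence, outside a set of residues of small proportion, `a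
n` depends only on `n` modulo `k ^ L`. Along any index sequence that tends to infinity and is
equidistributed modulo every `m`, the frequency of a letter is then within `ε` of a number that does
not depend on the sequence. Both `n` and `⌊n ^ c⌋` are such sequences; letting `ε → 0` gives
existence and equality of the limits (`DFAO.exists_forall_eventually_abs_cesaroMean_sub_le`).

The residue of `⌊n ^ c⌋` modulo `m` records the arc of the circle containing `n ^ c / m`, so Weyl's
criterion reduces equidistribution to exponential sums along `γ n ^ c`. If `k < c < k + 1`, the
differences of order `k + 1` have size `n ^ (c - k - 1)`: they decrease to 0, but more slowly than
`1 / n`. Van der Corput differencing, applied `k` times, leaves a phase whose first differences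
behave this way, and Fejér's theorem applies. For integral `c` the `c`-th difference is a nonzero
constant, and the argument fails. -/

open Filter Topology Finset ComplexConjugate MeasureTheory

/-! ### Cesàro means -/

/-- The average `N⁻¹ ∑_{n < N} u n` of the first `N` terms of a sequence. -/
noncomputable def cesaroMean {E : Type*} [AddCommGroup E] [Module ℝ E] (u : ℕ → E) (N : ℕ) : E :=
  (N : ℝ)⁻¹ • ∑ n ∈ range N, u n

section CesaroMean

variable {E : Type*} [NormedAddCommGroup E] [NormedSpace ℝ E]

theorem cesaroMean_add (u v : ℕ → E) (N : ℕ) :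
    cesaroMean (fun n => u n + v n) N = cesaroMean u N + cesaroMean v N := by
  simp [cesaroMean, sum_add_distrib]

theorem cesaroMean_sub (u v : ℕ → E) (N : ℕ) :
    cesaroMean (fun n => u n - v n) N = cesaroMean u N - cesaroMean v N := by
  simp [cesaroMean, smul_sub]

theorem cesaroMean_sum {ι : Type*} (s : Finset ι) (u : ι → ℕ → E) (N : ℕ) :
    cesaroMean (fun n => ∑ i ∈ s, u i n) N = ∑ i ∈ s, cesaroMean (u i) N := by
  simp only [cesaroMean]
  rw [sum_comm, smul_sum]

theorem norm_cesaroMean_le {u : ℕ → E} {v : ℕ → ℝ} (h : ∀ n, ‖u n‖ ≤ v n) (N : ℕ) :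
    ‖cesaroMean u N‖ ≤ cesaroMean v N := by
  simp only [cesaroMean, norm_smul, smul_eq_mul, norm_inv, Real.norm_natCast]
  gcongr
  exact norm_sum_le_of_le _ fun n _ => h n

theorem cesaroMean_const_le_one (N : ℕ) : cesaroMean (fun _ => (1 : ℝ)) N ≤ 1 := by
  simp only [cesaroMean, sum_const, card_range, nsmul_eq_mul, mul_one, smul_eq_mul]
  exact inv_mul_le_one

/-- Shifting a bounded sequence does not change its averages asymptotically. -/
theorem tendsto_cesaroMean_shift_sub {u : ℕ → E} {C : ℝ} (hu : ∀ n, ‖u n‖ ≤ C) (h : ℕ) :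
    Tendsto (fun N => cesaroMean (fun n => u (n + h)) N - cesaroMean u N) atTop (𝓝 0) := by
  induction h with
  | zero => simp
  | succ h ih =>
    have key : Tendsto (fun N => cesaroMean (fun n => u (n + (h + 1))) N
        - cesaroMean (fun n => u (n + h)) N) atTop (𝓝 0) := by
      have h0 : Tendsto (fun N : ℕ => (N : ℝ)⁻¹ * (C + C)) atTop (𝓝 0) := by
        simpa using (tendsto_inv_atTop_nhds_zero_nat (𝕜 := ℝ)).mul_const (C + C)
      refine squeeze_zero_norm (fun N => ?_) h0
      rw [← cesaroMean_sub, cesaroMean, norm_smul, norm_inv, Real.norm_natCast]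
      have := Finset.sum_range_sub (fun n => u (n + h)) N
      simp only [← add_assoc, add_right_comm _ h 1]
      rw [this]
      gcongr
      exact (norm_sub_le _ _).trans (add_le_add (hu _) (hu _))
    simpa using key.add ih

theorem tendsto_cesaroMean_shift {u : ℕ → E} {C : ℝ} (hu : ∀ n, ‖u n‖ ≤ C) (h : ℕ) {l : E} :
    Tendsto (cesaroMean (fun n => u (n + h))) atTop (𝓝 l) ↔
      Tendsto (cesaroMean u) atTop (𝓝 l) := by
  have hs := tendsto_cesaroMean_shift_sub hu h
  constructor
  · intro ht
    simpa using ht.sub hs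
  · intro ht
    simpa using ht.add hs

end CesaroMean

/-! ### Van der Corput differencing -/

/-- The square of an average is at most the average of the squares. -/
theorem norm_cesaroMean_sq_le (v : ℕ → ℂ) (N : ℕ) :
    ‖cesaroMean v N‖ ^ 2 ≤ cesaroMean (fun n => ‖v n‖ ^ 2) N := by
  rcases Nat.eq_zero_or_pos N with rfl | hN
  · simp [cesaroMean]
  have hN' : (0 : ℝ) < N := by exact_mod_cast hN
  have h1 : ‖∑ n ∈ range N, v n‖ ^ 2 ≤ N * ∑ n ∈ range N, ‖v n‖ ^ 2 := by
    calc ‖∑ n ∈ range N, v n‖ ^ 2 ≤ (∑ n ∈ range N, ‖v n‖) ^ 2 := by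
          gcongr
          exact norm_sum_le _ _
      _ ≤ _ := by simpa using sq_sum_le_card_mul_sum_sq (s := range N) (f := fun n => ‖v n‖)
  simp only [cesaroMean, norm_smul, norm_inv, Real.norm_natCast, smul_eq_mul, mul_pow]
  calc ((N : ℝ)⁻¹) ^ 2 * ‖∑ n ∈ range N, v n‖ ^ 2
      ≤ ((N : ℝ)⁻¹) ^ 2 * (N * ∑ n ∈ range N, ‖v n‖ ^ 2) := by gcongr
    _ = _ := by field_simp

/-- Van der Corput's difference theorem: if all the correlations of a sequence of unit complex
numbers vanish on average, then so does the sequence. -/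
theorem tendsto_cesaroMean_zero_of_correlations {u : ℕ → ℂ} (hu : ∀ n, ‖u n‖ = 1)
    (h : ∀ d, 0 < d → Tendsto (cesaroMean fun n => u (n + d) * conj (u n)) atTop (𝓝 0)) :
    Tendsto (cesaroMean u) atTop (𝓝 0) := by
  have hlt : ∀ i d : ℕ, 0 < d →
      Tendsto (cesaroMean fun n => u (n + (i + d)) * conj (u (n + i))) atTop (𝓝 0) := by
    intro i d hd
    have hb : ∀ n, ‖u (n + d) * conj (u n)‖ ≤ 1 := fun n => by simp [hu]
    have := (tendsto_cesaroMean_shift hb i).2 (h d hd)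
    simpa only [add_assoc] using this
  have hne : ∀ i j : ℕ, i ≠ j →
      Tendsto (cesaroMean fun n => u (n + i) * conj (u (n + j))) atTop (𝓝 0) := by
    intro i j hij
    rcases lt_or_gt_of_ne hij with hij | hij
    · obtain ⟨d, rfl⟩ := Nat.exists_eq_add_of_lt hij
      have h1 := (Complex.continuous_conj.tendsto (0 : ℂ)).comp (hlt i (d + 1) (by omega))
      rw [map_zero] at h1
      refine h1.congr fun N => ?_
      simp [cesaroMean, Complex.real_smul, mul_comm, add_assoc]
    · obtain ⟨d, rfl⟩ := Nat.exists_eq_add_of_lt hij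
      simpa only [add_assoc] using hlt j (d + 1) (by omega)
  -- The window sums `v` have mean square at most `H + 1` eventually: the `H` diagonal correlations
  -- contribute at most 1 each, and the others vanish in the limit. The term `1 / H` absorbs the
  -- error of replacing the mean of `v` by `H` times the mean of `u`.
  have bound : ∀ H : ℕ, 0 < H → ∀ᶠ N in atTop, ‖cesaroMean u N‖ ≤ √(H + 1) / H + 1 / H := by
    intro H hH
    have hH' : (0 : ℝ) < H := by exact_mod_cast hH
    set v : ℕ → ℂ := fun n => ∑ i ∈ range H, u (n + i) with hv
    have hexp : ∀ N, ((cesaroMean (fun n => ‖v n‖ ^ 2) N : ℝ) : ℂ) =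
        ∑ i ∈ range H, ∑ j ∈ range H, cesaroMean (fun n => u (n + i) * conj (u (n + j))) N := by
      intro N
      simp_rw [← cesaroMean_sum]
      simp only [cesaroMean, smul_eq_mul, Complex.real_smul, Complex.ofReal_mul,
        Complex.ofReal_sum]
      congr 1
      refine sum_congr rfl fun n _ => ?_
      rw [Complex.ofReal_pow, ← Complex.mul_conj', hv, map_sum, sum_mul_sum]
    have hoff : Tendsto (fun N => ∑ i ∈ range H, ∑ j ∈ (range H).erase i,
        cesaroMean (fun n => u (n + i) * conj (u (n + j))) N) atTop (𝓝 0) := by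
      have := tendsto_finsetSum (range H) fun i _ =>
        tendsto_finsetSum ((range H).erase i) fun j hj =>
          hne i j (ne_of_mem_erase hj).symm
      simpa using this
    have hsq : ∀ᶠ N in atTop, cesaroMean (fun n => ‖v n‖ ^ 2) N ≤ H + 1 := by
      filter_upwards [hoff.norm.eventually (gt_mem_nhds (by simp : ‖(0 : ℂ)‖ < 1))] with N hN
      have h0 : 0 ≤ cesaroMean (fun n => ‖v n‖ ^ 2) N := by
        simp only [cesaroMean, smul_eq_mul]
        positivity
      rw [← abs_of_nonneg h0, ← Real.norm_eq_abs, ← Complex.norm_real, hexp]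
      have hsplit : ∀ i ∈ range H,
          ∑ j ∈ range H, cesaroMean (fun n => u (n + i) * conj (u (n + j))) N =
          cesaroMean (fun n => u (n + i) * conj (u (n + i))) N +
          ∑ j ∈ (range H).erase i, cesaroMean (fun n => u (n + i) * conj (u (n + j))) N :=
        fun i hi => (add_sum_erase _ _ hi).symm
      rw [sum_congr rfl hsplit, sum_add_distrib]
      refine (norm_add_le _ _).trans (add_le_add ?_ hN.le)
      calc _ ≤ ∑ i ∈ range H, (1 : ℝ) := by
            refine norm_sum_le_of_le _ fun i _ => ?_
            exact (norm_cesaroMean_le (v := fun _ => 1) (fun n => by simp [hu]) N).trans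
              (cesaroMean_const_le_one N)
        _ = H := by simp
    have hshift : Tendsto (fun N => cesaroMean v N - H * cesaroMean u N) atTop (𝓝 0) := by
      have := tendsto_finsetSum (range H) fun i _ =>
        tendsto_cesaroMean_shift_sub (fun n => (hu n).le) i
      simp only [sum_sub_distrib, sum_const, card_range, nsmul_eq_mul, mul_zero] at this
      refine this.congr fun N => ?_
      rw [← cesaroMean_sum]
    filter_upwards [hsq, hshift.norm.eventually (gt_mem_nhds (by simp : ‖(0 : ℂ)‖ < 1))]
      with N h1 h2
    have h3 : ‖cesaroMean v N‖ ≤ √(H + 1) :=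
      Real.le_sqrt_of_sq_le ((norm_cesaroMean_sq_le v N).trans h1)
    have h4 : ‖(H : ℂ) * cesaroMean u N‖ ≤ √(H + 1) + 1 := by
      have := norm_sub_norm_le ((H : ℂ) * cesaroMean u N) (cesaroMean v N)
      rw [norm_sub_rev] at this
      linarith
    rw [norm_mul, Complex.norm_natCast] at h4
    rw [← add_div, le_div_iff₀ hH']
    linarith
  have hlim : Tendsto (fun H : ℕ => √((H : ℝ) + 1) / H + 1 / H) atTop (𝓝 0) := by
    have h1 : Tendsto (fun H : ℕ => 1 / (H : ℝ)) atTop (𝓝 0) := tendsto_one_div_atTop_nhds_zero_nat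
    have h2 : Tendsto (fun H : ℕ => √(1 / (H : ℝ) + (1 / (H : ℝ)) ^ 2)) atTop (𝓝 0) := by
      have := (h1.add (h1.pow 2)).sqrt
      simpa using this
    have h3 := h2.add h1
    rw [add_zero] at h3
    refine h3.congr' ?_
    filter_upwards [eventually_gt_atTop 0] with H hH
    have hH' : (0 : ℝ) < H := by exact_mod_cast hH
    congr 1
    rw [eq_div_iff hH'.ne', ← Real.sqrt_sq hH'.le, ← Real.sqrt_mul (by positivity),
      Real.sqrt_sq hH'.le]
    congr 1
    field_simp
  rw [Metric.tendsto_atTop']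
  intro ε hε
  obtain ⟨H, hH0, hH⟩ := ((eventually_gt_atTop 0).and (hlim.eventually (gt_mem_nhds hε))).exists
  obtain ⟨N, hN⟩ := eventually_atTop.1 (bound H hH0)
  exact ⟨N, fun n hn => by simpa using (hN n hn.le).trans_lt hH⟩

/-! ### Fejér's theorem -/

/-- Summation by parts bound for the increments of a sequence in the unit ball against
nonnegative increasing weights. -/
theorem norm_sum_increments_mul_le {u : ℕ → ℂ} (hu : ∀ n, ‖u n‖ ≤ 1) {g : ℕ → ℝ}
    (hg : Monotone g) (hg0 : ∀ n, 0 ≤ g n) (N : ℕ) :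
    ‖∑ n ∈ range N, (u (n + 1) - u n) * (g n : ℂ)‖ ≤ 2 * g N := by
  have hparts : ∑ n ∈ range N, (u (n + 1) - u n) * (g n : ℂ) =
      u N * g N - u 0 * g 0 - ∑ n ∈ range N, u (n + 1) * ((g (n + 1) - g n : ℝ) : ℂ) := by
    induction N with
    | zero => simp
    | succ N ih =>
      rw [sum_range_succ, sum_range_succ, ih]
      push_cast
      ring
  have hg' : ∀ n, ‖u n * (g n : ℂ)‖ ≤ g n := fun n => by
    rw [norm_mul, Complex.norm_real, Real.norm_eq_abs, abs_of_nonneg (hg0 n)]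
    exact mul_le_of_le_one_left (hg0 n) (hu n)
  have hsum : ‖∑ n ∈ range N, u (n + 1) * ((g (n + 1) - g n : ℝ) : ℂ)‖ ≤ g N - g 0 := by
    rw [← sum_range_sub]
    refine norm_sum_le_of_le _ fun n _ => ?_
    have := sub_nonneg.2 (hg n.le_succ)
    rw [norm_mul, Complex.norm_real, Real.norm_eq_abs, abs_of_nonneg this]
    exact mul_le_of_le_one_left this (hu _)
  rw [hparts]
  have h1 := norm_sub_le (u N * g N - u 0 * g 0)
    (∑ n ∈ range N, u (n + 1) * ((g (n + 1) - g n : ℝ) : ℂ))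
  have h2 := norm_sub_le (u N * (g N : ℂ)) (u 0 * g 0)
  linarith [hg' N, hg' 0]

/-- A discrete form of Fejér's theorem. -/
theorem tendsto_cesaroMean_exp_of_antitone_increments {y : ℕ → ℝ}
    (hpos : ∀ n, 0 < y (n + 1) - y n) (hanti : Antitone fun n => y (n + 1) - y n)
    (hzero : Tendsto (fun n => y (n + 1) - y n) atTop (𝓝 0))
    (htop : Tendsto (fun n : ℕ => n * (y (n + 1) - y n)) atTop atTop) :
    Tendsto (cesaroMean fun n => Complex.exp (y n * Complex.I)) atTop (𝓝 0) := by
  set d : ℕ → ℝ := fun n => y (n + 1) - y n with hd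
  replace hpos : ∀ n, 0 < d n := hpos
  set u : ℕ → ℂ := fun n => Complex.exp (y n * Complex.I) with hu
  have hun : ∀ n, ‖u n‖ = 1 := fun n => Complex.norm_exp_ofReal_mul_I _
  -- Since `u (n + 1) - u n = u n * (exp (i d n) - 1)` is about `i * d n * u n`, the term `u n` is
  -- nearly an increment of `u` divided by `i * d n`. The error `r n` is at most `d n`; the
  -- increments are summed by parts and average to at most `2 / (N * d N)`.
  set r : ℕ → ℂ := fun n => u n - -Complex.I * ((u (n + 1) - u n) * ((d n)⁻¹ : ℝ)) with hr
  have hr0 : Tendsto r atTop (𝓝 0) := by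
    refine squeeze_zero_norm' ?_ hzero
    filter_upwards [hzero.eventually (gt_mem_nhds one_pos)] with n hn
    have hdn : (d n : ℂ) ≠ 0 := by exact_mod_cast (hpos n).ne'
    have hnorm : ‖(d n : ℂ) * Complex.I‖ = d n := by
      rw [norm_mul, Complex.norm_real, Complex.norm_I, mul_one, Real.norm_eq_abs,
        abs_of_pos (hpos n)]
    have hstep : u (n + 1) = u n * Complex.exp (d n * Complex.I) := by
      simp only [hu, hd, ← Complex.exp_add]
      congr 1
      push_cast
      ring
    have hrn : r n = Complex.I * u n * (d n : ℂ)⁻¹ *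
        (Complex.exp (d n * Complex.I) - 1 - d n * Complex.I) := by
      simp only [hr, hstep, Complex.ofReal_inv]
      field_simp
      linear_combination (u n * (d n : ℂ)) * Complex.I_sq
    rw [hrn, norm_mul, norm_mul, norm_mul, hun, Complex.norm_I, norm_inv, Complex.norm_real,
      Real.norm_eq_abs, abs_of_pos (hpos n)]
    have h1 := Complex.norm_exp_sub_one_sub_id_le (x := d n * Complex.I) (by rw [hnorm]; exact hn.le)
    rw [hnorm] at h1
    have hp := hpos n
    calc 1 * 1 * (d n)⁻¹ * ‖Complex.exp (d n * Complex.I) - 1 - d n * Complex.I‖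
        ≤ 1 * 1 * (d n)⁻¹ * d n ^ 2 := by
          have := inv_pos.2 hp
          gcongr
      _ = d n := by field_simp
  have hmain : Tendsto (cesaroMean fun n => (u (n + 1) - u n) * (((d n)⁻¹ : ℝ) : ℂ)) atTop
      (𝓝 0) := by
    have hlim : Tendsto (fun N : ℕ => 2 * ((N : ℝ) * d N)⁻¹) atTop (𝓝 0) := by
      simpa using (tendsto_inv_atTop_zero.comp htop).const_mul 2
    refine squeeze_zero_norm (fun N => ?_) hlim
    rw [cesaroMean, norm_smul, norm_inv, Real.norm_natCast, mul_inv, mul_left_comm]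
    gcongr
    exact norm_sum_increments_mul_le (g := fun n => (d n)⁻¹) (fun n => (hun n).le)
      (fun i j hij => inv_anti₀ (hpos j) (hanti hij)) (fun n => (inv_pos.2 (hpos n)).le) N
  have hsum := hr0.cesaro_smul.add (hmain.const_mul (-Complex.I))
  rw [mul_zero, add_zero] at hsum
  refine hsum.congr fun N => ?_
  simp only [cesaroMean, Complex.real_smul]
  rw [mul_left_comm, ← mul_add, mul_sum, ← sum_add_distrib]
  congr 1
  refine sum_congr rfl fun n _ => ?_
  simp [hr]

/-! ### Iterated differences of powers -/

/-- The `k`-th differences of `y` are positive and decrease to zero, slower than `1 / n`. -/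
structure HasSlowDiff (k : ℕ) (y : ℕ → ℝ) : Prop where
  pos : ∀ n, 0 < (fwdDiff 1)^[k] y n
  antitone : Antitone ((fwdDiff 1)^[k] y)
  tendsto_zero : Tendsto ((fwdDiff 1)^[k] y) atTop (𝓝 0)
  tendsto_mul_atTop : Tendsto (fun n : ℕ => n * (fwdDiff 1)^[k] y n) atTop atTop

/-- A shift by `h` telescopes into `h` unit steps, so taking `y (n + h) - y n` uses up one order of
differencing. -/
theorem fwdDiff_iter_shift_sub (y : ℕ → ℝ) (k h n : ℕ) :
    (fwdDiff 1)^[k] (fun n => y (n + h) - y n) n = ∑ j ∈ range h, (fwdDiff 1)^[k + 1] y (n + j) := by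
  have h1 : (fun n => y (n + h) - y n) = (fun n => y (n + h)) + (-1 : ℝ) • y := by
    ext n
    simp [sub_eq_add_neg]
  rw [h1, fwdDiff_iter_add, fwdDiff_iter_const_smul, Pi.add_apply, fwdDiff_iter_comp_add]
  have h2 := Finset.sum_range_sub (fun j => (fwdDiff 1)^[k] y (n + j)) h
  simp only [Function.iterate_succ_apply', fwdDiff, Pi.smul_apply, smul_eq_mul] at h2 ⊢
  simp only [add_assoc]
  rw [h2]
  simp
  ring

theorem HasSlowDiff.shift_sub {k : ℕ} {y : ℕ → ℝ} (hy : HasSlowDiff (k + 1) y) {h : ℕ}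
    (hh : 0 < h) : HasSlowDiff k fun n => y (n + h) - y n := by
  have heq : (fwdDiff 1)^[k] (fun n => y (n + h) - y n) =
      fun n => ∑ j ∈ range h, (fwdDiff 1)^[k + 1] y (n + j) :=
    funext fun n => fwdDiff_iter_shift_sub y k h n
  refine ⟨?_, ?_, ?_, ?_⟩ <;> rw [heq]
  · exact fun n => sum_pos (fun j _ => hy.pos _) (by simpa using hh.ne')
  · exact fun a b hab => sum_le_sum fun j _ => hy.antitone (by omega)
  · have := tendsto_finsetSum (range h) fun j _ =>
      hy.tendsto_zero.comp (tendsto_add_atTop_nat j)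
    simpa using this
  · refine tendsto_atTop_mono (fun n => ?_) hy.tendsto_mul_atTop
    gcongr
    exact single_le_sum (f := fun j => (fwdDiff 1)^[k + 1] y (n + j)) (fun j _ => (hy.pos _).le)
      (mem_range.2 hh)

/-- Each correlation of `exp (i y n)` is again an exponential, with phase `y (n + d) - y n`, whose
slow differences occur one order lower. Order one is Fejér's theorem. -/
theorem HasSlowDiff.tendsto_cesaroMean_exp {k : ℕ} {y : ℕ → ℝ} (hy : HasSlowDiff (k + 1) y) :
    Tendsto (cesaroMean fun n => Complex.exp (y n * Complex.I)) atTop (𝓝 0) := by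
  induction k generalizing y with
  | zero =>
    exact tendsto_cesaroMean_exp_of_antitone_increments hy.pos hy.antitone hy.tendsto_zero
      hy.tendsto_mul_atTop
  | succ k ih =>
    refine tendsto_cesaroMean_zero_of_correlations
      (fun n => Complex.norm_exp_ofReal_mul_I _) fun d hd => ?_
    convert ih (hy.shift_sub hd) using 3 with n
    rw [← Complex.exp_conj, ← Complex.exp_add]
    congr 1
    simp
    ring

/-- Mean value theorem for iterated differences. -/
theorem exists_fwdDiff_iter_eq_deriv (k : ℕ) {F : ℕ → ℝ → ℝ}
    (hF : ∀ i x, 0 < x → HasDerivAt (F i) (F (i + 1) x) x) {x : ℝ} (hx : 0 < x) :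
    ∃ ξ ∈ Set.Icc x (x + k), (fwdDiff 1)^[k] (F 0) x = F k ξ := by
  induction k generalizing F with
  | zero => exact ⟨x, by simp, rfl⟩
  | succ k ih =>
    -- The family of differences `F i (x + 1) - F i x` is also a chain of derivatives, so one
    -- application of the mean value theorem remains.
    obtain ⟨ξ, ⟨h1, h2⟩, hξ⟩ := ih (F := fun i => fwdDiff 1 (F i)) fun i x hx =>
      ((hF i (x + 1) (by positivity)).comp_add_const x 1).sub (hF i x hx)
    have hξ0 : 0 < ξ := hx.trans_le h1
    obtain ⟨η, ⟨h3, h4⟩, hη⟩ := exists_hasDerivAt_eq_slope (F k) (F (k + 1))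
      (lt_add_one ξ)
      (fun z hz => (hF k z (hξ0.trans_le hz.1)).continuousAt.continuousWithinAt)
      (fun z hz => hF k z (hξ0.trans hz.1))
    refine ⟨η, ⟨h1.trans h3.le, ?_⟩, ?_⟩
    · push_cast
      linarith
    · rw [Function.iterate_succ_apply, hξ, hη]
      simp [fwdDiff]

theorem fwdDiff_iter_comp_natCast (f : ℝ → ℝ) (k n : ℕ) :
    (fwdDiff 1)^[k] (fun n : ℕ => f (n + 1)) n = (fwdDiff 1)^[k] f (n + 1) := by
  induction k generalizing n with
  | zero => rfl
  | succ k ih =>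
    simp only [Function.iterate_succ_apply', fwdDiff, ih]
    push_cast
    rfl

/-- The sequence `γ (n + 1) ^ c` has slowly decaying differences of order `⌈c⌉`. -/
theorem hasSlowDiff_rpow {γ c : ℝ} (hγ : 0 < γ) {k : ℕ} (hk : k < c) (hk' : c < k + 1) :
    HasSlowDiff (k + 1) fun n : ℕ => γ * ((n : ℝ) + 1) ^ c := by
  set F : ℕ → ℝ → ℝ := fun i x => (γ * ∏ j ∈ range i, (c - j)) * x ^ (c - i) with hFdef
  have hF : ∀ i x, 0 < x → HasDerivAt (F i) (F (i + 1) x) x := by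
    intro i x hx
    have := (Real.hasDerivAt_rpow_const (p := c - i) (Or.inl hx.ne')).const_mul
      (γ * ∏ j ∈ range i, (c - j))
    refine this.congr_deriv ?_
    simp only [hFdef, prod_range_succ]
    push_cast
    rw [sub_sub]
    ring
  have hF0 : F 0 = fun x => γ * x ^ c := by
    simp [hFdef]
  have hdiff : ∀ i n : ℕ, ∃ ξ ∈ Set.Icc ((n : ℝ) + 1) (n + 1 + i),
      (fwdDiff 1)^[i] (fun n : ℕ => γ * ((n : ℝ) + 1) ^ c) n = F i ξ := by
    intro i n
    rw [fwdDiff_iter_comp_natCast (fun x => γ * x ^ c), ← hF0]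
    exact exists_fwdDiff_iter_eq_deriv i hF (by positivity)
  -- All factors `c - j` with `j ≤ k` are positive; the next one, `c - (k + 1)`, is negative. This
  -- gives positivity and monotonicity of `D`.
  set K : ℝ := γ * ∏ j ∈ range (k + 1), (c - j) with hK
  have hKpos : 0 < K := by
    refine mul_pos hγ (prod_pos fun j hj => ?_)
    have : (j : ℝ) ≤ k := by exact_mod_cast Nat.lt_succ_iff.1 (mem_range.1 hj)
    linarith
  have hexp : c - ((k + 1 : ℕ) : ℝ) < 0 := by
    push_cast
    linarith
  set D := (fwdDiff 1)^[k + 1] (fun n : ℕ => γ * ((n : ℝ) + 1) ^ c) with hD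
  have hpos : ∀ n, 0 < D n := by
    intro n
    obtain ⟨ξ, ⟨h1, -⟩, h⟩ := hdiff (k + 1) n
    rw [hD, h]
    have : 0 < ξ := lt_of_lt_of_le (by positivity) h1
    exact mul_pos hKpos (Real.rpow_pos_of_pos this _)
  have hupper : ∀ n, D n ≤ K * ((n : ℝ) + 1) ^ (c - ((k + 1 : ℕ) : ℝ)) := by
    intro n
    obtain ⟨ξ, ⟨h1, -⟩, h⟩ := hdiff (k + 1) n
    rw [hD, h]
    exact mul_le_mul_of_nonneg_left
      (Real.rpow_le_rpow_of_nonpos (by positivity) h1 hexp.le) hKpos.le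
  have hlower : ∀ n : ℕ, K * ((n : ℝ) + (k + 2)) ^ (c - ((k + 1 : ℕ) : ℝ)) ≤ D n := by
    intro n
    obtain ⟨ξ, ⟨h1, h2⟩, h⟩ := hdiff (k + 1) n
    rw [hD, h]
    have hξ : 0 < ξ := lt_of_lt_of_le (by positivity) h1
    refine mul_le_mul_of_nonneg_left
      (Real.rpow_le_rpow_of_nonpos hξ ?_ hexp.le) hKpos.le
    push_cast at h2
    linarith
  refine ⟨hpos, antitone_nat_of_succ_le fun n => ?_, ?_, ?_⟩
  · obtain ⟨ξ, ⟨h1, -⟩, h⟩ := hdiff (k + 1 + 1) n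
    rw [Function.iterate_succ_apply', ← hD] at h
    have hξ : 0 < ξ := lt_of_lt_of_le (by positivity) h1
    have hneg : F (k + 1 + 1) ξ ≤ 0 := by
      simp only [hFdef]
      rw [prod_range_succ, ← mul_assoc]
      refine mul_nonpos_of_nonpos_of_nonneg ?_ (Real.rpow_nonneg hξ.le _)
      exact mul_nonpos_of_nonneg_of_nonpos hKpos.le hexp.le
    rw [← h] at hneg
    exact sub_nonpos.1 hneg
  · refine squeeze_zero (fun n => (hpos n).le) hupper ?_
    have h1 : Tendsto (fun n : ℕ => (n : ℝ) + 1) atTop atTop :=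
      tendsto_atTop_add_const_right _ _ tendsto_natCast_atTop_atTop
    have h2 := (tendsto_rpow_neg_atTop (neg_pos.2 hexp)).comp h1
    rw [neg_neg] at h2
    simpa using h2.const_mul K
  · have hc' : 0 < c - k := sub_pos.2 hk
    have h1 : Tendsto (fun n : ℕ => (n : ℝ) + (k + 2)) atTop atTop :=
      tendsto_atTop_add_const_right _ _ tendsto_natCast_atTop_atTop
    have h2 := ((tendsto_rpow_atTop hc').comp h1).const_mul_atTop (half_pos hKpos)
    refine tendsto_atTop_mono' _ ?_ h2
    -- From here on `n + (k + 2) ≤ 2 * n`, which accounts for the factor `K / 2`.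
    filter_upwards [eventually_ge_atTop (k + 2)] with n hn
    have hn' : ((k : ℝ) + 2) ≤ n := by exact_mod_cast hn
    have hz : 0 < (n : ℝ) + (k + 2) := by positivity
    have hsplit : ((n : ℝ) + (k + 2)) ^ (c - k) =
        ((n : ℝ) + (k + 2)) ^ (c - ((k + 1 : ℕ) : ℝ)) * (n + (k + 2)) := by
      rw [← Real.rpow_add_one hz.ne']
      congr 1
      push_cast
      ring
    have hr := Real.rpow_pos_of_pos hz (c - ((k + 1 : ℕ) : ℝ))
    calc K / 2 * ((n : ℝ) + (k + 2)) ^ (c - k)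
        = K * ((n : ℝ) + (k + 2)) ^ (c - ((k + 1 : ℕ) : ℝ)) * ((n + (k + 2)) / 2) := by
          rw [hsplit]
          ring
      _ ≤ K * ((n : ℝ) + (k + 2)) ^ (c - ((k + 1 : ℕ) : ℝ)) * n := by
          gcongr
          linarith
      _ ≤ n * D n := by
          rw [mul_comm]
          gcongr
          exact hlower n

/-- The exponential sums along `γ n ^ c` vanish on average for non-integral `c > 0`. -/
theorem tendsto_cesaroMean_exp_rpow {γ c : ℝ} (hγ : 0 < γ) (hc : 0 < c)
    (hcz : ∀ m : ℤ, c ≠ m) :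
    Tendsto (cesaroMean fun n : ℕ => Complex.exp ((γ * (n : ℝ) ^ c : ℝ) * Complex.I)) atTop
      (𝓝 0) := by
  have hk : ((⌊c⌋₊ : ℕ) : ℝ) < c :=
    lt_of_le_of_ne (Nat.floor_le hc.le) fun h => hcz ⌊c⌋₊ (by simpa using h.symm)
  have h := (hasSlowDiff_rpow hγ hk (Nat.lt_floor_add_one c)).tendsto_cesaroMean_exp
  rw [← tendsto_cesaroMean_shift (C := 1) (fun n => (Complex.norm_exp_ofReal_mul_I _).le) 1]
  push_cast at h ⊢
  exact h

/-! ### Weyl's criterion -/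

theorem integral_fourier_unitAddCircle {h : ℤ} (hh : h ≠ 0) :
    ∫ t : UnitAddCircle, fourier h t = 0 :=
  integral_eq_zero_of_add_right_eq_neg (g := ((1 / 2 / h : ℝ) : UnitAddCircle))
    fun t => fourier_add_half_inv_index hh one_pos t

/-- Weyl's criterion, for continuous test functions. -/
theorem tendsto_cesaroMean_continuousMap {x : ℕ → UnitAddCircle}
    (hx : ∀ h : ℤ, h ≠ 0 → Tendsto (cesaroMean fun n => (fourier h (x n) : ℂ)) atTop (𝓝 0))
    (f : C(UnitAddCircle, ℂ)) :
    Tendsto (cesaroMean fun n => f (x n)) atTop (𝓝 (∫ t, f t)) := by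
  have hint : ∀ g : C(UnitAddCircle, ℂ), Integrable (fun t => g t) := fun g =>
    g.continuous.integrable_of_hasCompactSupport (HasCompactSupport.of_compactSpace _)
  have hspan : ∀ g ∈ Submodule.span ℂ (Set.range (@fourier 1)),
      Tendsto (cesaroMean fun n => g (x n)) atTop (𝓝 (∫ t, g t)) := by
    intro g hg
    induction hg using Submodule.span_induction with
    | mem g hg =>
      obtain ⟨h, rfl⟩ := hg
      rcases eq_or_ne h 0 with rfl | hh
      · have hc : ∀ᶠ N in atTop, cesaroMean (fun _ => (1 : ℂ)) N = 1 := by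
          filter_upwards [eventually_gt_atTop 0] with N hN
          have : (N : ℂ) ≠ 0 := by exact_mod_cast hN.ne'
          simp [cesaroMean, this]
        simp only [fourier_zero, integral_const, measureReal_def, UnitAddCircle.measure_univ,
          ENNReal.toReal_one, one_smul]
        exact tendsto_const_nhds.congr' (hc.mono fun _ h => h.symm)
      · rw [integral_fourier_unitAddCircle hh]
        exact hx h hh
    | zero =>
      simp only [ContinuousMap.zero_apply, integral_zero]
      exact tendsto_const_nhds.congr fun N => by simp [cesaroMean]
    | add g₁ g₂ _ _ h₁ h₂ =>
      simp only [ContinuousMap.add_apply]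
      rw [integral_add (hint g₁) (hint g₂)]
      exact (h₁.add h₂).congr fun N => (cesaroMean_add _ _ N).symm
    | smul z g _ h =>
      simp only [ContinuousMap.smul_apply, integral_smul]
      refine (h.const_smul z).congr fun N => ?_
      simp only [cesaroMean, smul_sum]
      exact sum_congr rfl fun n _ => smul_comm _ _ _
  rw [Metric.tendsto_atTop']
  intro ε hε
  have hf : f ∈ closure (Submodule.span ℂ (Set.range (@fourier 1)) : Set C(UnitAddCircle, ℂ)) := by
    rw [← Submodule.topologicalClosure_coe, span_fourier_closure_eq_top]
    trivial
  obtain ⟨g, hg, hfg⟩ := Metric.mem_closure_iff.1 hf (ε / 3) (by positivity)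
  obtain ⟨N, hN⟩ := Metric.tendsto_atTop'.1 (hspan g hg) (ε / 3) (by positivity)
  refine ⟨N, fun n hn => ?_⟩
  rw [dist_eq_norm] at hfg
  have hpt : ∀ t, ‖f t - g t‖ ≤ ε / 3 := fun t => ((f - g).norm_coe_le_norm t).trans hfg.le
  have h1 : dist (cesaroMean (fun n => f (x n)) n) (cesaroMean (fun n => g (x n)) n) ≤ ε / 3 := by
    rw [dist_eq_norm, ← cesaroMean_sub]
    refine (norm_cesaroMean_le (v := fun _ => ε / 3) (fun n => hpt _) n).trans ?_
    simp only [cesaroMean, sum_const, card_range, nsmul_eq_mul, smul_eq_mul, ← mul_assoc]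
    exact mul_le_of_le_one_left (by positivity) inv_mul_le_one
  have h2 : dist (∫ t, g t) (∫ t, f t) ≤ ε / 3 := by
    rw [dist_comm, dist_eq_norm, ← integral_sub (hint f) (hint g)]
    refine (norm_integral_le_of_norm_le_const (Eventually.of_forall hpt)).trans ?_
    simp [measureReal_def]
  have h3 := hN n hn
  have h4 := dist_triangle4 (cesaroMean (fun n => f (x n)) n) (cesaroMean (fun n => g (x n)) n)
    (∫ t, g t) (∫ t, f t)
  linarith

/-- Weyl's criterion bounds the proportion of time spent in an arc by its length. -/
theorem eventually_cesaroMean_indicator_closedBall_le {x : ℕ → UnitAddCircle}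
    (hx : ∀ h : ℤ, h ≠ 0 → Tendsto (cesaroMean fun n => (fourier h (x n) : ℂ)) atTop (𝓝 0))
    (z : UnitAddCircle) {ρ ε : ℝ} (hρ : 0 ≤ ρ) (hε : 0 < ε) :
    ∀ᶠ N in atTop,
      cesaroMean (fun n => (Metric.closedBall z ρ).indicator (fun _ => (1 : ℝ)) (x n)) N
        ≤ 2 * ρ + ε := by
  set δ : ℝ := ε / 4 with hδdef
  have hδ : 0 < δ := by positivity
  -- A continuous trapezoid between the indicators of the balls of radius `ρ` and `ρ + δ`; with `δ =
  -- ε / 4` its integral is at most `2 * ρ + ε / 2`.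
  set g : UnitAddCircle → ℝ := fun t => max 0 (min 1 ((ρ + δ - dist t z) / δ)) with hg
  have hgc : Continuous g := by fun_prop
  have hg0 : ∀ t, 0 ≤ g t := fun t => le_max_left _ _
  have hg1 : ∀ t, g t ≤ 1 := fun t => max_le zero_le_one (min_le_left _ _)
  have hlow : ∀ t, (Metric.closedBall z ρ).indicator (fun _ => (1 : ℝ)) t ≤ g t := by
    intro t
    refine Set.indicator_le' (fun t ht => ?_) (fun t _ => hg0 t) t
    refine le_max_of_le_right (le_min le_rfl ?_)
    rw [one_le_div hδ]
    linarith [Metric.mem_closedBall.1 ht]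
  have hup : ∀ t, g t ≤ (Metric.closedBall z (ρ + δ)).indicator (fun _ => (1 : ℝ)) t := by
    intro t
    by_cases ht : t ∈ Metric.closedBall z (ρ + δ)
    · rw [Set.indicator_of_mem ht]
      exact hg1 t
    · rw [Set.indicator_of_notMem ht]
      rw [Metric.mem_closedBall, not_le] at ht
      refine max_le le_rfl ((min_le_right _ _).trans ?_)
      exact div_nonpos_of_nonpos_of_nonneg (by linarith) hδ.le
  have hint : ∫ t, g t ≤ 2 * (ρ + δ) := by
    calc ∫ t, g t ≤ ∫ t, (Metric.closedBall z (ρ + δ)).indicator (fun _ => (1 : ℝ)) t := by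
          refine integral_mono
            (hgc.integrable_of_hasCompactSupport (HasCompactSupport.of_compactSpace _)) ?_ hup
          exact (integrable_const 1).indicator Metric.isClosed_closedBall.measurableSet
      _ = (volume (Metric.closedBall z (ρ + δ))).toReal := by
          rw [integral_indicator_const _ Metric.isClosed_closedBall.measurableSet]
          simp [measureReal_def]
      _ ≤ 2 * (ρ + δ) := by
          rw [AddCircle.volume_closedBall]
          exact ENNReal.toReal_le_of_le_ofReal (by positivity)
            (ENNReal.ofReal_le_ofReal (min_le_right _ _))
  have hlim : Tendsto (cesaroMean fun n => g (x n)) atTop (𝓝 (∫ t, g t)) := by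
    have h := tendsto_cesaroMean_continuousMap hx
      ⟨fun t => (g t : ℂ), Complex.continuous_ofReal.comp hgc⟩
    simp only [ContinuousMap.coe_mk, integral_complex_ofReal] at h
    have h' := (Complex.continuous_re.tendsto _).comp h
    rw [Complex.ofReal_re] at h'
    refine h'.congr fun N => ?_
    simp [cesaroMean]
  filter_upwards [hlim.eventually (gt_mem_nhds (show ∫ t, g t < 2 * ρ + ε by linarith))]
    with N hN
  refine le_trans ?_ hN.le
  simp only [cesaroMean, smul_eq_mul]
  gcongr with n
  exact hlow _

theorem hasFrequency_iff_tendsto_cesaroMean {A : Type*} [DecidableEq A] (b : ℕ → A) (α : A)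
    (θ : ℝ) : HasFrequency b α θ ↔
      Tendsto (cesaroMean fun n => if b n = α then (1 : ℝ) else 0) atTop (𝓝 θ) := by
  have hcard : ∀ N : ℕ, Set.ncard {n : ℕ | n < N ∧ b n = α} = #{n ∈ range N | b n = α} := by
    intro N
    rw [← Set.ncard_coe_finset]
    congr 1
    ext n
    simp
  rw [HasFrequency]
  refine tendsto_congr fun N => ?_
  rw [hcard, cesaroMean, smul_eq_mul, sum_boole, div_eq_inv_mul]

/-! ### Equidistribution in residue classes -/

/-- Every residue class modulo every `m` is hit with the same frequency `1 / m`. -/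
def EquidistributedMod (b : ℕ → ℕ) : Prop :=
  ∀ m : ℕ, 0 < m → ∀ r < m, HasFrequency (fun n => b n % m) r (1 / m)

/-- Asymptotic upper bounds `1 / m` for all residue classes modulo `m` already imply
equidistribution. -/
theorem hasFrequency_mod_of_eventually_le {b : ℕ → ℕ} {m : ℕ} (hm : 0 < m)
    (hb : ∀ r < m, ∀ ε > (0 : ℝ), ∀ᶠ N in atTop,
      cesaroMean (fun n => if b n % m = r then (1 : ℝ) else 0) N ≤ 1 / m + ε) {r : ℕ}
    (hr : r < m) : HasFrequency (fun n => b n % m) r (1 / m) := by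
  rw [hasFrequency_iff_tendsto_cesaroMean, Metric.tendsto_atTop']
  intro ε hε
  have hm' : (0 : ℝ) < m := by exact_mod_cast hm
  have hall : ∀ᶠ N in atTop, ∀ s ∈ range m,
      cesaroMean (fun n => if b n % m = s then (1 : ℝ) else 0) N ≤ 1 / m + ε / (2 * m) :=
    (Filter.eventually_all_finset _).2 fun s hs => hb s (mem_range.1 hs) _ (by positivity)
  obtain ⟨N, hN⟩ := eventually_atTop.1 (hall.and (eventually_gt_atTop 0))
  refine ⟨N, fun n hn => ?_⟩
  obtain ⟨h1, hn0⟩ := hN n hn.le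
  have hn0' : (n : ℝ) ≠ 0 := by exact_mod_cast hn0.ne'
  have htotal : ∑ s ∈ range m, cesaroMean (fun n => if b n % m = s then (1 : ℝ) else 0) n = 1 := by
    rw [← cesaroMean_sum]
    have : ∀ n, ∑ s ∈ range m, (if b n % m = s then (1 : ℝ) else 0) = 1 := fun n => by
      rw [sum_ite_eq, if_pos (mem_range.2 (Nat.mod_lt _ hm))]
    simp [this, cesaroMean, hn0']
  rw [← add_sum_erase _ _ (mem_range.2 hr)] at htotal
  -- The frequencies sum to 1, so upper bounds on the other `m - 1` classes bound class `r` from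
  -- below; the tolerance `ε / (2 * m)` keeps their total error below `ε`.
  have hrest : ∑ s ∈ (range m).erase r,
      cesaroMean (fun n => if b n % m = s then (1 : ℝ) else 0) n ≤
        (m - 1) * (1 / m + ε / (2 * m)) := by
    refine (sum_le_card_nsmul _ _ _ fun s hs => h1 s (mem_of_mem_erase hs)).trans_eq ?_
    rw [card_erase_of_mem (mem_range.2 hr), card_range, nsmul_eq_mul, Nat.cast_pred hm]
  have hexpand : ((m : ℝ) - 1) * (1 / m + ε / (2 * m)) = 1 - 1 / m + ε / 2 - ε / (2 * m) := by
    field_simp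
    ring
  have hpos : 0 < ε / (2 * m) := by positivity
  have hle : ε / (2 * m) ≤ ε / 2 := by
    gcongr
    have : (1 : ℝ) ≤ m := by exact_mod_cast hm
    linarith
  have hr1 := h1 r (mem_range.2 hr)
  rw [Real.dist_eq, abs_lt]
  constructor <;> linarith

/-- A real number whose integer part is `r` modulo `m` lies, after division by `m`, in an arc of
length `1 / m`. -/
theorem coe_div_mem_closedBall_of_floor_mod {y : ℝ} (hy : 0 ≤ y) {m r : ℕ} (hm : 0 < m)
    (h : ⌊y⌋₊ % m = r) :
    ((y / m : ℝ) : UnitAddCircle) ∈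
      Metric.closedBall (((r + 1 / 2) / m : ℝ) : UnitAddCircle) (1 / (2 * m)) := by
  have hm' : (0 : ℝ) < m := by exact_mod_cast hm
  have hq : ((⌊y⌋₊ : ℕ) : ℝ) = m * (⌊y⌋₊ / m : ℕ) + r := by
    rw [← h]
    exact_mod_cast (Nat.div_add_mod _ _).symm
  have h1 := Nat.floor_le hy
  have h2 := Nat.lt_floor_add_one y
  set q : ℕ := ⌊y⌋₊ / m with hqdef
  -- Removing the integer `q` does not move the point on the circle, and `y - m * q` lies within `1
  -- / 2` of the midpoint of `[r, r + 1]`.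
  have hcoe : ((y / m : ℝ) : UnitAddCircle) = ((y / m - q : ℝ) : UnitAddCircle) := by
    rw [AddCircle.coe_sub]
    have : ((q : ℝ) : UnitAddCircle) = 0 := by
      have := AddCircle.coe_period (1 : ℝ)
      rw [← mul_one (q : ℝ), ← nsmul_eq_mul, AddCircle.coe_nsmul, this, smul_zero]
    rw [this, sub_zero]
  rw [hcoe, Metric.mem_closedBall, dist_eq_norm, ← AddCircle.coe_sub]
  refine (QuotientAddGroup.norm_mk_le_norm).trans ?_
  have : y / m - q - (r + 1 / 2) / m = (y - (m * q + r) - 1 / 2) / m := by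
    field_simp
    ring
  rw [this, Real.norm_eq_abs, abs_div, abs_of_pos hm', ← div_div]
  gcongr
  rw [abs_le]
  constructor <;> linarith

/-- The integer parts of `n ^ c` are equidistributed in residue classes for non-integral `c`. -/
theorem equidistributedMod_floor_rpow {c : ℝ} (hc : 0 < c) (hcz : ∀ m : ℤ, c ≠ m) :
    EquidistributedMod fun n : ℕ => ⌊(n : ℝ) ^ c⌋₊ := by
  intro m hm r hr
  have hm' : (0 : ℝ) < m := by exact_mod_cast hm
  refine hasFrequency_mod_of_eventually_le hm (fun s hs ε hε => ?_) hr
  have hpos : ∀ h : ℤ, 0 < h → Tendsto (cesaroMean fun n : ℕ =>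
      (fourier h (((n : ℝ) ^ c / m : ℝ) : UnitAddCircle) : ℂ)) atTop (𝓝 0) := by
    intro h hh
    have hh' : (0 : ℝ) < h := by exact_mod_cast hh
    convert tendsto_cesaroMean_exp_rpow (γ := 2 * Real.pi * h / m) (by positivity) hc hcz
      using 3 with n
    rw [fourier_coe_apply]
    congr 1
    push_cast
    ring
  -- Negative frequencies follow from positive ones by conjugation.
  have hW : ∀ h : ℤ, h ≠ 0 → Tendsto (cesaroMean fun n : ℕ =>
      (fourier h (((n : ℝ) ^ c / m : ℝ) : UnitAddCircle) : ℂ)) atTop (𝓝 0) := by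
    intro h hh
    rcases lt_or_gt_of_ne hh with hh | hh
    · have h1 := (Complex.continuous_conj.tendsto (0 : ℂ)).comp (hpos (-h) (by omega))
      rw [map_zero] at h1
      refine h1.congr fun N => ?_
      simp only [Function.comp_apply, cesaroMean, Complex.real_smul, map_mul, map_sum,
        Complex.conj_ofReal, fourier_neg, Complex.conj_conj]
    · exact hpos h hh
  filter_upwards [eventually_cesaroMean_indicator_closedBall_le hW
    (((s + 1 / 2) / m : ℝ) : UnitAddCircle) (ρ := 1 / (2 * m)) (by positivity) hε] with N hN
  have h2 : 2 * (1 / (2 * (m : ℝ))) = 1 / m := by field_simp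
  rw [h2] at hN
  refine le_trans ?_ hN
  simp only [cesaroMean, smul_eq_mul]
  gcongr with n
  split_ifs with hn
  · rw [Set.indicator_of_mem
      (coe_div_mem_closedBall_of_floor_mod (Real.rpow_nonneg (Nat.cast_nonneg n) c) hm hn)]
  · exact Set.indicator_nonneg (fun _ _ => zero_le_one) _

theorem equidistributedMod_id : EquidistributedMod fun n => n := by
  intro m hm r hr
  refine hasFrequency_mod_of_eventually_le hm (fun s hs ε hε => ?_) hr
  have hm' : (0 : ℝ) < m := by exact_mod_cast hm
  have hlim : Tendsto (fun N : ℕ => (N : ℝ)⁻¹) atTop (𝓝 0) := tendsto_inv_atTop_nhds_zero_nat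
  filter_upwards [hlim.eventually (gt_mem_nhds hε), eventually_gt_atTop 0] with N hN hN0
  have hN' : (0 : ℝ) < N := by exact_mod_cast hN0
  have hcard : #{n ∈ range N | n % m = s} ≤ N / m + 1 := by
    have h := Nat.count_modEq_card N hm s
    rw [Nat.count_eq_card_filter_range] at h
    simp only [Nat.ModEq, Nat.mod_eq_of_lt hs] at h
    rw [h]
    split_ifs <;> omega
  have hcard' : (#{n ∈ range N | n % m = s} : ℝ) ≤ N / m + 1 :=
    calc (#{n ∈ range N | n % m = s} : ℝ) ≤ ((N / m : ℕ) : ℝ) + 1 := by exact_mod_cast hcard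
      _ ≤ N / m + 1 := by
        gcongr
        exact Nat.cast_div_le
  rw [cesaroMean, smul_eq_mul, sum_boole]
  calc (N : ℝ)⁻¹ * #{n ∈ range N | n % m = s} ≤ (N : ℝ)⁻¹ * (N / m + 1) := by gcongr
    _ = 1 / m + (N : ℝ)⁻¹ := by field_simp
    _ ≤ 1 / m + ε := by gcongr

/-! ### Reset words and residues modulo powers of the base -/

namespace DFAO

variable {k : ℕ} {σ A : Type*} (M : DFAO k σ A) (hk : 1 < k)

/-- The state reached from `q` after reading the last `L` base-`k` digits of `n` (padded with
leading zeros), most significant digit first. -/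
def runDigits : ℕ → σ → ℕ → σ
  | 0, q, _ => q
  | L + 1, q, n => M.step (runDigits L q (n / k)) ⟨n % k, Nat.mod_lt _ (by omega)⟩

theorem run_digitExpansion_of_ne_zero (q : σ) {n : ℕ} (hn : n ≠ 0) :
    M.run q (digitExpansion k hk n) =
      M.step (M.run q (digitExpansion k hk (n / k))) ⟨n % k, Nat.mod_lt _ (by omega)⟩ := by
  simp only [digitExpansion, run, Nat.digits_eq_cons_digits_div hk hn, List.pmap_cons,
    List.reverse_cons, List.foldl_append, List.foldl_cons, List.foldl_nil]

/-- The bound `k ^ L ≤ n` ensures that the last `L` digits are genuine digits of `n` and not padding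
zeros. -/
theorem run_digitExpansion_eq_runDigits (q : σ) (L : ℕ) {n : ℕ} (hn : k ^ L ≤ n) :
    M.run q (digitExpansion k hk n) =
      M.runDigits hk L (M.run q (digitExpansion k hk (n / k ^ L))) n := by
  induction L generalizing n with
  | zero => simp [runDigits]
  | succ L ih =>
    have hn0 : n ≠ 0 := (lt_of_lt_of_le (pow_pos (by omega) _) hn).ne'
    have hle : k ^ L ≤ n / k := by
      rw [Nat.le_div_iff_mul_le (by omega), ← pow_succ]
      exact hn
    rw [run_digitExpansion_of_ne_zero M hk q hn0, ih hle, runDigits, Nat.div_div_eq_div_mul,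
      ← pow_succ']

theorem runDigits_mod (L : ℕ) (q : σ) (n : ℕ) :
    M.runDigits hk L q (n % k ^ L) = M.runDigits hk L q n := by
  induction L generalizing n with
  | zero => rfl
  | succ L ih =>
    simp only [runDigits]
    have h1 : n % k ^ (L + 1) / k = n / k % k ^ L := by
      rw [pow_succ', Nat.mod_mul_right_div_self]
    have h2 : n % k ^ (L + 1) % k = n % k :=
      Nat.mod_mod_of_dvd _ (dvd_pow_self k L.succ_ne_zero)
    simp only [h1, h2, ih]

theorem runDigits_add (L j : ℕ) (q : σ) (n : ℕ) :
    M.runDigits hk (L + j) q n = M.runDigits hk j (M.runDigits hk L q (n / k ^ j)) n := by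
  induction j generalizing n with
  | zero => simp [runDigits]
  | succ j ih =>
    rw [← add_assoc, runDigits, ih, runDigits, Nat.div_div_eq_div_mul, ← pow_succ']

/-- The residue is the value of `w` in base `k`; padding to the length of `w` preserves leading
zeros of `w`. -/
theorem exists_runDigits_eq_run (w : List (Fin k)) :
    ∃ r < k ^ w.length, ∀ q, M.runDigits hk w.length q r = M.run q w := by
  induction w using List.reverseRecOn with
  | nil => exact ⟨0, by simp, fun q => rfl⟩
  | append_singleton w d ih =>
    obtain ⟨r, hr, h⟩ := ih
    have hk0 : 0 < k := by omega
    have h1 : (k * r + d) / k = r := by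
      rw [Nat.mul_add_div hk0, Nat.div_eq_of_lt d.2, add_zero]
    have h2 : (k * r + d) % k = d := by
      rw [Nat.mul_add_mod, Nat.mod_eq_of_lt d.2]
    refine ⟨k * r + d, ?_, fun q => ?_⟩
    · rw [List.length_append, List.length_singleton, pow_succ']
      calc k * r + d < k * r + k := by have := d.2; omega
        _ = k * (r + 1) := by ring
        _ ≤ k * k ^ w.length := Nat.mul_le_mul_left _ hr
    · rw [List.length_append, List.length_singleton, runDigits]
      simp only [h1, h2, h]
      simp [run]

open Classical in
/-- The residues modulo `k ^ L` whose digits do not reset the automaton. -/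
noncomputable def nonresetting (L : ℕ) : Finset ℕ :=
  {r ∈ range (k ^ L) | ¬ ∃ s, ∀ q, M.runDigits hk L q r = s}

theorem mem_nonresetting {L r : ℕ} : r ∈ M.nonresetting hk L ↔
    r < k ^ L ∧ ¬ ∃ s, ∀ q, M.runDigits hk L q r = s := by
  simp [nonresetting]

/-- If a residue does not reset, neither does its leading part of `L` digits, and its final block
differs from `w`: one value out of `k ^ w.length` is lost. -/
theorem card_nonresetting_add_le {w : List (Fin k)} (hw : M.IsSynchronizingWord w) (L : ℕ) :
    #(M.nonresetting hk (L + w.length)) ≤ #(M.nonresetting hk L) * (k ^ w.length - 1) := by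
  obtain ⟨v, hv, hvw⟩ := M.exists_runDigits_eq_run hk w
  obtain ⟨s, hs⟩ := hw
  have hcard : #((range (k ^ w.length)).erase v) = k ^ w.length - 1 := by
    rw [card_erase_of_mem (mem_range.2 hv), card_range]
  rw [← hcard, ← card_product]
  have hpos : 0 < k ^ w.length := pow_pos (by omega) _
  refine card_le_card_of_injOn (fun r => (r / k ^ w.length, r % k ^ w.length)) ?_ ?_
  · intro r hr
    obtain ⟨hlt, hr⟩ := (M.mem_nonresetting hk).1 hr
    simp only [runDigits_add] at hr
    refine mem_coe.2 (mem_product.2 ⟨(M.mem_nonresetting hk).2 ⟨?_, ?_⟩, mem_erase.2 ⟨?_, ?_⟩⟩)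
    · rw [Nat.div_lt_iff_lt_mul hpos, ← pow_add]
      exact hlt
    · rintro ⟨t, ht⟩
      exact hr ⟨_, fun q => by rw [ht q]⟩
    · intro (h : r % k ^ w.length = v)
      refine hr ⟨s, fun q => ?_⟩
      rw [← runDigits_mod, h, hvw, hs]
    · exact mem_range.2 (Nat.mod_lt _ hpos)
  · intro r _ r' _ h
    simp only [Prod.mk.injEq] at h
    rw [← Nat.div_add_mod r (k ^ w.length), ← Nat.div_add_mod r' (k ^ w.length), h.1, h.2]

theorem card_nonresetting_mul_le {w : List (Fin k)} (hw : M.IsSynchronizingWord w) (j : ℕ) :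
    #(M.nonresetting hk (j * w.length)) ≤ (k ^ w.length - 1) ^ j := by
  induction j with
  | zero =>
    classical
    rw [zero_mul, pow_zero]
    exact (card_le_card (filter_subset _ _)).trans (by simp)
  | succ j ih =>
    rw [add_mul, one_mul, pow_succ]
    exact (M.card_nonresetting_add_le hk hw _).trans (Nat.mul_le_mul_right _ ih)

/-- For a synchronizing automaton, all but a small proportion of the residues modulo some power of
`k` reset the automaton. -/
theorem exists_card_nonresetting_div_lt {w : List (Fin k)} (hw : M.IsSynchronizingWord w) {ε : ℝ}
    (hε : 0 < ε) : ∃ L : ℕ, (#(M.nonresetting hk L) : ℝ) / (k ^ L : ℕ) < ε := by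
  have hpos : 0 < k ^ w.length := pow_pos (by omega) _
  have hpos' : (0 : ℝ) < (k ^ w.length : ℕ) := by exact_mod_cast hpos
  obtain ⟨j, hj⟩ := exists_pow_lt_of_lt_one hε
    (show ((k ^ w.length - 1 : ℕ) : ℝ) / (k ^ w.length : ℕ) < 1 by
      rw [div_lt_one hpos']
      exact_mod_cast Nat.sub_lt hpos one_pos)
  refine ⟨j * w.length, lt_of_le_of_lt ?_ hj⟩
  rw [div_pow, mul_comm j, pow_mul, Nat.cast_pow (k ^ w.length) j]
  gcongr
  rw [mul_comm]
  exact_mod_cast M.card_nonresetting_mul_le hk hw j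

/-- Up to an arbitrarily small error, the frequency of `α` along an equidistributed sequence of
indices tending to infinity does not depend on that sequence. -/
theorem exists_forall_eventually_abs_cesaroMean_sub_le [DecidableEq A] {a : ℕ → A}
    (ha : M.Generates hk a) {w : List (Fin k)} (hw : M.IsSynchronizingWord w) (α : A) {ε : ℝ}
    (hε : 0 < ε) : ∃ g : ℝ, ∀ b : ℕ → ℕ, Tendsto b atTop atTop → EquidistributedMod b →
      ∀ᶠ N in atTop, |cesaroMean (fun n => if a (b n) = α then (1 : ℝ) else 0) N - g| < ε := by
  classical
  obtain ⟨L, hL⟩ := M.exists_card_nonresetting_div_lt hk hw (half_pos hε)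
  have hpos : 0 < k ^ L := pow_pos (by omega) _
  set B := M.nonresetting hk L with hB
  -- For a resetting residue the choice of `M.start` is immaterial: every starting state leads to
  -- the same output.
  set G : Finset ℕ :=
    {r ∈ range (k ^ L) | r ∉ B ∧ M.output (M.runDigits hk L M.start r) = α} with hG
  refine ⟨#G / (k ^ L : ℕ), fun b hb hequi => ?_⟩
  have hfreq : ∀ S ⊆ range (k ^ L), Tendsto
      (cesaroMean fun n => ∑ r ∈ S, if b n % k ^ L = r then (1 : ℝ) else 0) atTop
      (𝓝 (#S / (k ^ L : ℕ))) := by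
    intro S hS
    have h := tendsto_finsetSum S fun r hr =>
      (hasFrequency_iff_tendsto_cesaroMean _ _ _).1 (hequi _ hpos r (mem_range.1 (hS hr)))
    rw [sum_const, nsmul_eq_mul, mul_one_div] at h
    exact h.congr fun N => (cesaroMean_sum _ _ _).symm
  have hGlim := hfreq G (filter_subset _ _)
  have hBlim := hfreq B (filter_subset _ _)
  have hsmall : Tendsto (cesaroMean fun n => if b n < k ^ L then (1 : ℝ) else 0) atTop (𝓝 0) := by
    refine Tendsto.cesaro_smul (tendsto_const_nhds.congr' ?_)
    filter_upwards [hb.eventually_ge_atTop (k ^ L)] with n hn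
    rw [if_neg hn.not_gt]
  -- The indicator of `a (b n) = α` and its periodic model differ only if `b n` falls in a
  -- nonresetting class or is too short to have `L` genuine digits guaranteed; the latter has
  -- density 0 because `b` tends to infinity.
  have hpt : ∀ n, ‖(if a (b n) = α then (1 : ℝ) else 0) -
      ∑ r ∈ G, (if b n % k ^ L = r then (1 : ℝ) else 0)‖ ≤
      (∑ r ∈ B, if b n % k ^ L = r then (1 : ℝ) else 0) + if b n < k ^ L then (1 : ℝ) else 0 := by
    intro n
    simp only [sum_ite_eq]
    by_cases hn : b n < k ^ L
    · rw [if_pos hn]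
      split_ifs <;> norm_num
    rw [if_neg hn, add_zero]
    by_cases hbad : b n % k ^ L ∈ B
    · rw [if_pos hbad]
      split_ifs <;> norm_num
    have hlt := Nat.mod_lt (b n) hpos
    have hreset : ∃ s, ∀ q, M.runDigits hk L q (b n % k ^ L) = s := by
      by_contra h
      exact hbad ((M.mem_nonresetting hk).2 ⟨hlt, h⟩)
    obtain ⟨s, hs⟩ := hreset
    have hmem : b n % k ^ L ∈ G ↔ a (b n) = α := by
      rw [hG, mem_filter, mem_range, ← ha, M.run_digitExpansion_eq_runDigits hk _ L (not_lt.1 hn),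
        ← M.runDigits_mod hk L _ (b n), hs, hs]
      simp [hlt, hbad]
    simp [hmem, hbad]
  have herr := hBlim.add hsmall
  rw [add_zero] at herr
  filter_upwards [herr.eventually (gt_mem_nhds hL),
    (Metric.tendsto_nhds.1 hGlim) (ε / 2) (half_pos hε)] with N h1 h2
  have h3 := norm_cesaroMean_le hpt N
  rw [cesaroMean_sub, cesaroMean_add, Real.norm_eq_abs] at h3
  rw [Real.dist_eq] at h2
  have h4 := abs_sub_le (cesaroMean (fun n => if a (b n) = α then (1 : ℝ) else 0) N)
    (cesaroMean (fun n => ∑ r ∈ G, if b n % k ^ L = r then (1 : ℝ) else 0) N)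
    (#G / (k ^ L : ℕ))
  linarith

end DFAO

/-! ### Conclusion -/

theorem tendsto_floor_rpow_atTop {c : ℝ} (hc : 0 < c) :
    Tendsto (fun n : ℕ => ⌊(n : ℝ) ^ c⌋₊) atTop atTop :=
  tendsto_nat_floor_atTop.comp ((tendsto_rpow_atTop hc).comp tendsto_natCast_atTop_atTop)

theorem theorem1 {A : Type*} (a : ℕ → A) (ha : IsSynchronizingAutomatic a)
    (c : ℝ) (hc : 1 < c) (hcz : ∀ m : ℤ, c ≠ (m : ℝ)) (α : A) :
    ∃ θ : ℝ, HasFrequency a α θ ∧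
      HasFrequency (fun n : ℕ => a ⌊(n : ℝ) ^ c⌋₊) α θ := by
  classical
  obtain ⟨k, hk, σ, -, M, hM, w, hw⟩ := ha
  have hc0 : 0 < c := one_pos.trans hc
  set f : ℕ → ℝ := cesaroMean fun n => if a n = α then (1 : ℝ) else 0 with hf
  set f' : ℕ → ℝ := cesaroMean fun n => if a ⌊(n : ℝ) ^ c⌋₊ = α then (1 : ℝ) else 0 with hf'
  -- The same `g` serves both averages, so they are eventually within `2 * ε` of each other, and
  -- each oscillates by less than `2 * ε`.
  have key : ∀ ε > 0, ∃ g : ℝ, (∀ᶠ N in atTop, |f N - g| < ε) ∧ ∀ᶠ N in atTop, |f' N - g| < ε := by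
    intro ε hε
    obtain ⟨g, hg⟩ := M.exists_forall_eventually_abs_cesaroMean_sub_le hk hM hw α hε
    exact ⟨g, hg _ tendsto_id equidistributedMod_id,
      hg _ (tendsto_floor_rpow_atTop hc0) (equidistributedMod_floor_rpow hc0 hcz)⟩
  have hcauchy : CauchySeq f := by
    rw [Metric.cauchySeq_iff']
    intro ε hε
    obtain ⟨g, hg, -⟩ := key (ε / 2) (half_pos hε)
    obtain ⟨N, hN⟩ := eventually_atTop.1 hg
    refine ⟨N, fun n hn => ?_⟩
    have h1 := hN n hn
    have h2 := hN N le_rfl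
    rw [Real.dist_eq]
    rw [abs_lt] at *
    constructor <;> linarith
  obtain ⟨θ, hθ⟩ := cauchySeq_tendsto_of_complete hcauchy
  have hdiff : Tendsto (fun N => f' N - f N) atTop (𝓝 0) := by
    rw [Metric.tendsto_nhds]
    intro ε hε
    obtain ⟨g, hg, hg'⟩ := key (ε / 2) (half_pos hε)
    filter_upwards [hg, hg'] with N h1 h2
    rw [Real.dist_eq, sub_zero]
    rw [abs_lt] at *
    constructor <;> linarith
  refine ⟨θ, (hasFrequency_iff_tendsto_cesaroMean _ _ _).2 hθ,
    (hasFrequency_iff_tendsto_cesaroMean _ _ _).2 ?_⟩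
  simpa using hdiff.add hθ
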